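/- Let $(X,d)$ be a non-empty metric space with a doubling Borel measure $\mu$: $0<\mu(B)<\infty$ for every ball $B$, and $\mu(2B)\le c\,\mu(B)$ with $c$ independent of $B$. Here a ball is an open ball $B=B(x_B,r_B)$ with given center and radius $r_B\in(0,\infty)$, and $\lambda B=B(x_B,\lambda r_B)$. Let $c_\mu$ and $D>0$ be constants such that $\mu(B')/\mu(B)\le c_\mu\,(r_{B'}/r_B)^D$ whenever $B\subset B'$ are balls with $r_B\le r_{B'}$ (such constants exist by doubling). For $\eta>0$ write $\widehat B=(1+\eta)B$, and write $w_B=\frac1{\mu(B)}\int_B w\,d\mu$ for averages. Then there is a constant $C_\mu\ge1$, depending only on $\mu$ (and the choice of $c_\mu, D$), with the following properties. For $\tau\ge1$ and $\varepsilon>0$ put $$\varepsilon_0=\varepsilon_0(\mu,\tau)=\frac1{2C_\mu}\min\{1,\tau/3\}^D,\qquad p(\varepsilon)=\frac{\log\big(C_\mu^{-1}c_\mu\tau^D\varepsilon^{-1}\big)}{\log\big(2c_\mu\max\{\tau,3\}^D\big)} .$$ Then $p(\varepsilon)>1$ for $0<\varepsilon<\varepsilon_0$, and $p(\varepsilon)\to+\infty$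 as $\varepsilon\to0^+$. Moreover, for all $\tau\ge1$, $\eta>0$ and $1\le p<\infty$ there is a finite constant $C>0$, depending only on $\mu,c_\mu,D,\tau,\eta,p$, such that the following holds whenever $0<\varepsilon<\varepsilon_0$ and $p<p(\varepsilon)$. Let $B_0$ be a ball and let $0\le w\in L^1(\tau\widehat B_0)$ satisfy the local weak Gurov--Reshetnyak condition $$\frac1{\mu(B)}\int_B|w-w_B|\,d\mu\le\varepsilon\,w_{\tau B}\qquad\text{for every ball }B\text{ with }\tau B\subset\tau\widehat B_0 .$$ Then, for every ball $B$ with $\tau\widehat B\subset\tau\widehat B_0$, we have $w\in L^p(B)$, $$\Big(\frac1{\mu(B)}\int_B|w-w_B|^p\,d\mu\Big)^{1/p}\le C\,\varepsilon\,w_{\tau\widehat B},$$ and hence the weak reverse H\"older inequality $$\Big(\frac1{\mu(B)}\int_B w^p\,d\mu\Big)^{1/p}\le C\,w_{\tau\widehat B}.$$ -/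

import Mathlib

open MeasureTheory Metric Set Filter Topology

/-- A doubling measure on a metric space: every (open) ball of positive radius has positive and
finite measure, and `μ (2B) ≤ c μ (B)` for all balls `B`, with `c` independent of `B`. -/
def IsDoubling {X : Type*} [MetricSpace X] [MeasurableSpace X] (μ : Measure X) : Prop :=
  (∀ (x : X) (r : ℝ), 0 < r → 0 < μ (ball x r) ∧ μ (ball x r) < ⊤) ∧
    ∃ c : ℝ, ∀ (x : X) (r : ℝ), 0 < r → μ.real (ball x (2 * r)) ≤ c * μ.real (ball x r)

/-- The pair `(cμ, D)`, `D > 0`, satisfies `μ (B') / μ (B) ≤ cμ (r_{B'} / r_B) ^ D` for all balls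
`B ⊆ B'` with `r_B ≤ r_{B'}`. -/
def HasDoublingConstants {X : Type*} [MetricSpace X] [MeasurableSpace X] (μ : Measure X)
    (cμ D : ℝ) : Prop :=
  0 < D ∧ ∀ (x y : X) (r R : ℝ), 0 < r → r ≤ R → ball x r ⊆ ball y R →
    μ.real (ball y R) / μ.real (ball x r) ≤ cμ * (R / r) ^ D

/-- Every doubling measure has such a pair of constants. -/
theorem IsDoubling.exists_constants {X : Type*} [MetricSpace X] [MeasurableSpace X]
    {μ : Measure X} (hμ : IsDoubling μ) : ∃ cμ D : ℝ, HasDoublingConstants μ cμ D := by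
  obtain ⟨hpos, c, hc⟩ := hμ
  set a : ℝ := max c 2 with ha
  have ha2 : 2 ≤ a := le_max_right _ _
  have ha0 : 0 < a := by linarith
  have iter : ∀ (n : ℕ) (x : X) (r : ℝ), 0 < r →
      μ.real (ball x (2 ^ n * r)) ≤ a ^ n * μ.real (ball x r) := by
    intro n
    induction n with
    | zero => intro x r _; simp
    | succ n ih =>
      intro x r hr
      have h1 := hc x (2 ^ n * r) (by positivity)
      have h2 : c * μ.real (ball x (2 ^ n * r)) ≤ a * μ.real (ball x (2 ^ n * r)) :=
        mul_le_mul_of_nonneg_right (le_max_left _ _) measureReal_nonneg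
      have h3 := mul_le_mul_of_nonneg_left (ih x r hr) ha0.le
      have e : (2 : ℝ) ^ (n + 1) * r = 2 * (2 ^ n * r) := by ring
      rw [e]
      calc _ ≤ _ := h1
        _ ≤ _ := h2
        _ ≤ _ := h3
        _ = _ := by ring
  refine ⟨a ^ 2, Real.logb 2 a, Real.logb_pos (by norm_num) (by linarith), ?_⟩
  intro x y r R hr hrR hsub
  have hR : 0 < R := hr.trans_le hrR
  have ht : 1 ≤ R / r := (one_le_div hr).2 hrR
  have ht0 : 0 < R / r := by linarith
  have hmr : 0 < μ.real (ball x r) :=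
    ENNReal.toReal_pos (hpos x r hr).1.ne' (hpos x r hr).2.ne
  rw [div_le_iff₀ hmr]
  set n : ℕ := ⌈Real.logb 2 (R / r)⌉₊ with hn
  have hL0 : 0 ≤ Real.logb 2 (R / r) := Real.logb_nonneg (by norm_num) ht
  have hn1 : Real.logb 2 (R / r) ≤ n := Nat.le_ceil _
  have hn2 : (n : ℝ) < Real.logb 2 (R / r) + 1 := Nat.ceil_lt_add_one hL0
  have hpow : R / r ≤ 2 ^ n := by
    have := (Real.logb_le_iff_le_rpow (b := 2) (by norm_num) ht0).1 hn1
    rwa [Real.rpow_natCast] at this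
  have hRn : R ≤ 2 ^ n * r := (div_le_iff₀ hr).1 hpow
  have hxy : dist x y < R := hsub (mem_ball_self hr)
  have hinc : ball y R ⊆ ball x (2 ^ (n + 1) * r) := by
    apply ball_subset_ball'
    rw [dist_comm y x, pow_succ]
    linarith
  have hm : μ.real (ball y R) ≤ μ.real (ball x (2 ^ (n + 1) * r)) :=
    measureReal_mono hinc (hpos x _ (by positivity)).2.ne
  have hapow : a ^ (n + 1) ≤ a ^ 2 * (R / r) ^ Real.logb 2 a := by
    have e1 : (R / r) ^ Real.logb 2 a = a ^ Real.logb 2 (R / r) := by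
      rw [Real.rpow_def_of_pos ht0, Real.rpow_def_of_pos ha0, Real.logb, Real.logb]
      congr 1
      ring
    rw [e1, ← Real.rpow_natCast a (n + 1), ← Real.rpow_natCast a 2, ← Real.rpow_add ha0]
    apply Real.rpow_le_rpow_of_exponent_le (by linarith)
    push_cast
    linarith
  exact (hm.trans (iter (n + 1) x r hr)).trans (mul_le_mul_of_nonneg_right hapow hmr.le)

/-- The local weak Gurov-Reshetnyak condition on a set `S`:
`⨍_B |w - w_B| dμ ≤ ε w_{τB}` for every ball `B` with `τB ⊆ S`. -/
def WeakGurovReshetnyakOn {X : Type*} [MetricSpace X] [MeasurableSpace X] (μ : Measure X)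
    (τ ε : ℝ) (w : X → ℝ) (S : Set X) : Prop :=
  ∀ (x : X) (r : ℝ), 0 < r → ball x (τ * r) ⊆ S →
    ⨍ y in ball x r, |w y - ⨍ z in ball x r, w z ∂μ| ∂μ ≤ ε * ⨍ y in ball x (τ * r), w y ∂μ

/-- The exponent `p(ε) = log (Cμ⁻¹ cμ τ ^ D ε⁻¹) / log (2 cμ (max {τ, 3}) ^ D)`. -/
noncomputable def exponentGR (cμ D Cμ τ ε : ℝ) : ℝ :=
  Real.log (Cμ⁻¹ * cμ * τ ^ D * ε⁻¹) / Real.log (2 * cμ * (max τ 3) ^ D)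

/-- The smallness threshold `(2 Cμ)⁻¹ (min {1, τ / 3}) ^ D` for `ε`. -/
noncomputable def thresholdGR (D Cμ τ : ℝ) : ℝ :=
  1 / (2 * Cμ) * (min 1 (τ / 3)) ^ D

/-! ### Doubling measures: Vitali covering and Lebesgue points. -/

section DoublingMeasure

variable {X : Type*} [MetricSpace X] [MeasurableSpace X] {μ : Measure X}

/-! The proof is a good-λ argument. For a ball of radius `r` put `R = (1 + η) r`; let `c` and `W` be
the means of `w` over the concentric balls of radii `R` and `τR`, `f = |w - c|` and `ν = f dμ`. The
hypothesis on the `R`-ball says that `f` has mean at most `εW` there.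

At almost every point with `f > 4ℓ/3` choose a nearly maximal small ball `B` on which `f` has mean
above `ℓ`. In `B` the set `{f > 2ℓ/3}` has `ν`-mass at least `ℓ μ(B) / 3`, while the means of `f`
over `6B` and `6τB` are at most `ℓ`. So `|w_{6B} - c| ≤ ℓ`, and where `f > 4ℓ/3` the quantity `|w -
w_{6B}|` is at least `f/4`; the hypothesis on `6B` bounds the `ν`-mass of that set in `6B` by `4ε(c
+ ℓ) μ(6B)`. A Vitali selection sums these estimates (`withDensity_superlevel_le`): doubling the
level multiplies the `ν`-mass by a factor `q` comparable to `ε(c/ℓ + 1)`, at the price of a slightly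
larger ball.

Since `c` is at most a constant times `W`, starting at `ℓ` of size `LεW` with `L` large gives `q ≤
2^(-p)`, provided `ε 2^p` is small. The enlargements form a geometric series filling the annulus
between `r` and `R` (`withDensity_superlevel_decay`). Summing over dyadic levels bounds `∫ f^p` by a
multiple of `(εW)^p μ(B)` (`lintegral_rpow_le_of_superlevel_decay`). Replacing `c` by `w_B` costs
`O(εW)`, and the triangle inequality gives the reverse Hölder bound. The condition `p < p(ε)`
supplies the smallness of `ε 2^p`. -/

theorem IsDoubling.measure_ball_ne_top (hμ : IsDoubling μ) (x : X) (r : ℝ) :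
    μ (ball x r) ≠ ⊤ := by
  rcases le_or_gt r 0 with hr | hr
  · simp [ball_eq_empty.2 hr]
  · exact (hμ.1 x r hr).2.ne

theorem IsDoubling.measureReal_ball_pos (hμ : IsDoubling μ) (x : X) {r : ℝ} (hr : 0 < r) :
    0 < μ.real (ball x r) :=
  ENNReal.toReal_pos (hμ.1 x r hr).1.ne' (hμ.1 x r hr).2.ne

theorem HasDoublingConstants.measureReal_ball_le {cμ D : ℝ} (hcD : HasDoublingConstants μ cμ D)
    (hμ : IsDoubling μ) {x y : X} {r R : ℝ} (hr : 0 < r) (hrR : r ≤ R)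
    (hsub : ball x r ⊆ ball y R) :
    μ.real (ball y R) ≤ cμ * (R / r) ^ D * μ.real (ball x r) :=
  (div_le_iff₀ (hμ.measureReal_ball_pos x hr)).1 (hcD.2 x y r R hr hrR hsub)

theorem HasDoublingConstants.one_le [Nonempty X] {cμ D : ℝ} (hcD : HasDoublingConstants μ cμ D)
    (hμ : IsDoubling μ) : 1 ≤ cμ := by
  obtain ⟨x⟩ := ‹Nonempty X›
  have h := hcD.2 x x 1 1 one_pos le_rfl Subset.rfl
  rwa [div_self (hμ.measureReal_ball_pos x one_pos).ne', div_one, Real.one_rpow, mul_one] at h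

theorem IsDoubling.sigmaFinite (hμ : IsDoubling μ) : SigmaFinite μ := by
  rcases isEmpty_or_nonempty X with h | ⟨⟨x⟩⟩
  · rw [Measure.eq_zero_of_isEmpty μ]; infer_instance
  · exact ⟨⟨⟨fun n : ℕ => ball x n, fun _ => trivial,
      fun n => (hμ.measure_ball_ne_top x n).lt_top, iUnion_ball_nat x⟩⟩⟩

theorem IsDoubling.isLocallyFiniteMeasure (hμ : IsDoubling μ) : IsLocallyFiniteMeasure μ :=
  ⟨fun x => ⟨ball x 1, ball_mem_nhds x one_pos, (hμ.1 x 1 one_pos).2⟩⟩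

/-- The differentiation theorem is stated for closed balls. A closed ball of radius `2r` lies in the
open ball of radius `4r`, so doubling is used twice. -/
theorem IsDoubling.exists_measureReal_closedBall_le (hμ : IsDoubling μ) :
    ∃ c : ℝ, 0 ≤ c ∧ ∀ (x : X) (r : ℝ), 0 < r →
      μ.real (closedBall x (2 * r)) ≤ c * μ.real (ball x r) := by
  obtain ⟨c, hc⟩ := hμ.2
  refine ⟨c * c, mul_self_nonneg c, fun x r hr => ?_⟩
  rcases le_or_gt 0 c with h0 | h0
  · calc μ.real (closedBall x (2 * r)) ≤ μ.real (ball x (2 * (2 * r))) :=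
        measureReal_mono (closedBall_subset_ball (by linarith)) (hμ.measure_ball_ne_top _ _)
      _ ≤ c * μ.real (ball x (2 * r)) := hc x _ (by positivity)
      _ ≤ c * (c * μ.real (ball x r)) := mul_le_mul_of_nonneg_left (hc x r hr) h0
      _ = _ := by ring
  · have h1 := hc x r hr
    have h2 := hμ.measureReal_ball_pos x hr
    have h3 := hμ.measureReal_ball_pos x (r := 2 * r) (by positivity)
    nlinarith

theorem IsDoubling.measure_closedBall_ne_top (hμ : IsDoubling μ) (x : X) (r : ℝ) :
    μ (closedBall x r) ≠ ⊤ :=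
  measure_ne_top_of_subset (closedBall_subset_ball (lt_add_one r)) (hμ.measure_ball_ne_top _ _)

theorem IsDoubling.isUnifLocDoublingMeasure (hμ : IsDoubling μ) : IsUnifLocDoublingMeasure μ := by
  obtain ⟨c, hc0, hc⟩ := hμ.exists_measureReal_closedBall_le
  refine ⟨⟨c.toNNReal, ?_⟩⟩
  filter_upwards [self_mem_nhdsWithin] with r hr x
  rw [← ENNReal.ofReal_toReal (hμ.measure_closedBall_ne_top x (2 * r)),
    ← ENNReal.ofReal_toReal (hμ.measure_closedBall_ne_top x r)]
  change ENNReal.ofReal (μ.real (closedBall x (2 * r))) ≤ _ * ENNReal.ofReal (μ.real _)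
  rw [← ENNReal.ofReal, ← ENNReal.ofReal_mul hc0]
  refine ENNReal.ofReal_le_ofReal ((hc x r hr).trans ?_)
  exact mul_le_mul_of_nonneg_left
    (measureReal_mono ball_subset_closedBall (hμ.measure_closedBall_ne_top _ _)) hc0

variable [BorelSpace X]

/-- Vitali covering by open balls, with a countable disjoint subfamily. -/
theorem IsDoubling.exists_vitali_ball (hμ : IsDoubling μ) (E : Set X) (s : X → ℝ) (δ : ℝ)
    (hs : ∀ y ∈ E, 0 < s y ∧ s y ≤ δ) :
    ∃ u ⊆ E, u.Countable ∧ (u.PairwiseDisjoint fun y => ball y (s y)) ∧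
      E ⊆ ⋃ y ∈ u, ball y (6 * s y) := by
  obtain ⟨u, huE, hdisj, hcov⟩ := Vitali.exists_disjoint_subfamily_covering_enlargement_closedBall
    E id s δ (fun y hy => (hs y hy).2) 5 (by norm_num)
  have hdisj' : u.PairwiseDisjoint fun y => ball y (s y) :=
    hdisj.mono fun y => ball_subset_closedBall
  refine ⟨u, huE, ?_, hdisj', fun y hy => ?_⟩
  · have := hμ.sigmaFinite
    have h := Measure.countable_meas_pos_of_disjoint_iUnion (μ := μ)
      (As := fun y : u => ball (y : X) (s y)) (fun _ => isOpen_ball.measurableSet)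
      (fun a b hab => hdisj' a.2 b.2 (fun h => hab (Subtype.ext h)))
    have huniv : {y : u | 0 < μ (ball (y : X) (s y))} = univ :=
      eq_univ_of_forall fun y => (hμ.1 y _ (hs y (huE y.2)).1).1
    rw [huniv, countable_univ_iff] at h
    exact countable_coe_iff.1 h
  · obtain ⟨b, hb, hsub⟩ := hcov y hy
    have hpos := (hs b (huE hb)).1
    have h1 : y ∈ closedBall b (5 * s b) :=
      hsub (mem_closedBall_self (hs y hy).1.le)
    exact mem_iUnion₂.2 ⟨b, hb, closedBall_subset_ball (by linarith) h1⟩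

/-- Vitali centres at one fixed scale form a countable `ε`-net. The differentiation theorem needs
this. -/
theorem IsDoubling.secondCountableTopology (hμ : IsDoubling μ) : SecondCountableTopology X := by
  refine secondCountable_of_almost_dense_set fun ε hε => ?_
  obtain ⟨u, -, hu, -, hcov⟩ := hμ.exists_vitali_ball univ (fun _ => ε / 6) (ε / 6)
    (fun _ _ => ⟨by positivity, le_rfl⟩)
  refine ⟨u, hu, fun x => ?_⟩
  obtain ⟨y, hy, hxy⟩ := mem_iUnion₂.1 (hcov (mem_univ x))
  refine ⟨y, hy, ?_⟩
  rw [mem_ball] at hxy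
  linarith

/-- At almost every point `y`, averages over small open balls exceed any level below `g y`. -/
theorem IsDoubling.ae_eventually_lt_setIntegral_ball (hμ : IsDoubling μ) {g : X → ℝ}
    (hg : Integrable g μ) : ∀ᵐ y ∂μ, ∀ ℓ < g y, ∀ᶠ s in 𝓝[>] (0 : ℝ),
      ℓ * μ.real (ball y s) < ∫ z in ball y s, g z ∂μ := by
  have := hμ.secondCountableTopology
  have := hμ.isLocallyFiniteMeasure
  have := hμ.isUnifLocDoublingMeasure
  obtain ⟨c, hc0, hc⟩ := hμ.exists_measureReal_closedBall_le
  filter_upwards [IsUnifLocDoublingMeasure.ae_tendsto_average_norm_sub μ hg.locallyIntegrable 1]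
    with y hy ℓ hℓ
  have hlim := hy (l := 𝓝[>] (0 : ℝ)) (fun _ => y) id tendsto_id (by
    filter_upwards [self_mem_nhdsWithin] with s hs
    simpa using le_of_lt hs)
  -- Passing from the closed to the open ball costs the factor `c`; dividing by `c + 1` keeps the
  -- final inequality strict.
  have hκ : 0 < (g y - ℓ) / (c + 1) := div_pos (sub_pos.2 hℓ) (by linarith)
  filter_upwards [hlim.eventually (gt_mem_nhds hκ), self_mem_nhdsWithin] with s hs hs0
  have hs0 : 0 < s := hs0
  have hb := hμ.measureReal_ball_pos y hs0
  have hcb : 0 < μ.real (closedBall y s) := hb.trans_le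
    (measureReal_mono ball_subset_closedBall (hμ.measure_closedBall_ne_top _ _))
  have hcc : μ.real (closedBall y s) ≤ c * μ.real (ball y s) :=
    (measureReal_mono (closedBall_subset_closedBall (by linarith))
      (hμ.measure_closedBall_ne_top _ _)).trans (hc y s hs0)
  simp only [id] at hs
  rw [setAverage_eq, smul_eq_mul, inv_mul_lt_iff₀ hcb] at hs
  have hfin : IsFiniteMeasure (μ.restrict (closedBall y s)) :=
    isFiniteMeasure_restrict.2 (hμ.measure_closedBall_ne_top _ _)
  have hfin' : IsFiniteMeasure (μ.restrict (ball y s)) :=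
    isFiniteMeasure_restrict.2 (hμ.measure_ball_ne_top _ _)
  have h1 : ∫ z in ball y s, ‖g z - g y‖ ∂μ ≤ ∫ z in closedBall y s, ‖g z - g y‖ ∂μ :=
    setIntegral_mono_set (hg.integrableOn.sub (integrable_const _)).norm
      (ae_of_all _ fun _ => norm_nonneg _) ball_subset_closedBall.eventuallyLE
  have h2 : ∫ z in ball y s, (g y - g z) ∂μ ≤ ∫ z in ball y s, ‖g z - g y‖ ∂μ := by
    refine integral_mono ((integrable_const _).sub hg.integrableOn)
      (hg.integrableOn.sub (integrable_const _)).norm fun z => ?_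
    rw [norm_sub_rev]
    exact le_abs_self _
  rw [integral_sub (integrable_const _) hg.integrableOn, setIntegral_const, smul_eq_mul] at h2
  have h3 : μ.real (closedBall y s) * ((g y - ℓ) / (c + 1)) < μ.real (ball y s) * (g y - ℓ) := by
    rw [mul_div_assoc', div_lt_iff₀ (by linarith)]
    have := mul_pos hb (sub_pos.2 hℓ)
    nlinarith [mul_le_mul_of_nonneg_right hcc (sub_pos.2 hℓ).le]
  linarith

end DoublingMeasure

/-! ### Stopping radii and estimates on one ball. -/

theorem exists_maximal_up_to_two {P : ℝ → Prop} {δ : ℝ} (h : ∃ s, 0 < s ∧ s ≤ δ ∧ P s) :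
    ∃ s, 0 < s ∧ s ≤ δ ∧ P s ∧ ∀ t, 2 * s ≤ t → t ≤ δ → ¬ P t := by
  set A : Set ℝ := {s | 0 < s ∧ s ≤ δ ∧ P s} with hA
  have hbdd : BddAbove A := ⟨δ, fun s hs => hs.2.1⟩
  obtain ⟨s₀, hs₀⟩ := h
  have hpos : 0 < sSup A := hs₀.1.trans_le (le_csSup hbdd hs₀)
  -- The supremum need not be attained; any admissible radius above half of it suffices.
  obtain ⟨s, hs, hlt⟩ := exists_lt_of_lt_csSup (s := A) ⟨s₀, hs₀⟩ (half_lt_self hpos)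
  refine ⟨s, hs.1, hs.2.1, hs.2.2, fun t ht htδ hP => ?_⟩
  have := le_csSup hbdd (show t ∈ A from ⟨by linarith [hs.1], htδ, hP⟩)
  linarith

section Superlevel

variable {X : Type*} [MeasurableSpace X] {μ : Measure X}

/-- If the average of `f ≥ 0` over `B` exceeds `ℓ`, then `{f > 2ℓ/3}` carries a third of it. -/
theorem mul_measureReal_le_setIntegral_superlevel {f : X → ℝ} {B : Set X} (hB : MeasurableSet B)
    (hBfin : μ B ≠ ⊤) (hf : Measurable f) (hfi : IntegrableOn f B μ) {ℓ : ℝ}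
    (h : ℓ * μ.real B < ∫ z in B, f z ∂μ) (hℓ : 0 ≤ ℓ) :
    ℓ / 3 * μ.real B ≤ ∫ z in B ∩ {z | 2 / 3 * ℓ < f z}, f z ∂μ := by
  have hS : MeasurableSet {z | 2 / 3 * ℓ < f z} := measurableSet_lt measurable_const hf
  have h1 := integral_inter_add_sdiff hS hfi
  have h2 : ∫ z in B \ {z | 2 / 3 * ℓ < f z}, f z ∂μ ≤ 2 / 3 * ℓ * μ.real B := by
    calc _ ≤ ∫ z in B \ {z | 2 / 3 * ℓ < f z}, 2 / 3 * ℓ ∂μ := by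
          refine setIntegral_mono_on (hfi.mono_set sdiff_subset)
            (integrableOn_const (measure_ne_top_of_subset sdiff_subset hBfin)) (hB.diff hS) ?_
          intro z hz
          exact not_lt.1 hz.2
      _ = 2 / 3 * ℓ * μ.real (B \ {z | 2 / 3 * ℓ < f z}) := by
          rw [setIntegral_const, smul_eq_mul, mul_comm]
      _ ≤ _ := mul_le_mul_of_nonneg_left (measureReal_mono sdiff_subset hBfin) (by positivity)
  linarith

theorem abs_setAverage_sub_le {w : X → ℝ} {B : Set X} (hB0 : 0 < μ.real B)
    (hBfin : μ B ≠ ⊤) (hw : IntegrableOn w B μ) (c : ℝ) :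
    |(⨍ z in B, w z ∂μ) - c| * μ.real B ≤ ∫ z in B, |w z - c| ∂μ := by
  have : IsFiniteMeasure (μ.restrict B) := isFiniteMeasure_restrict.2 hBfin
  have h1 : (⨍ z in B, w z ∂μ) * μ.real B = ∫ z in B, w z ∂μ := by
    rw [setAverage_eq, smul_eq_mul]; field_simp
  have h2 : ∫ z in B, (w z - c) ∂μ = ((⨍ z in B, w z ∂μ) - c) * μ.real B := by
    rw [integral_sub hw (integrable_const _), setIntegral_const, smul_eq_mul, sub_mul, h1,
      mul_comm c]
  calc _ = |∫ z in B, (w z - c) ∂μ| := by rw [h2, abs_mul, abs_of_pos hB0]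
    _ ≤ _ := abs_integral_le_integral_abs

/-- On `{|w - c| > 4ℓ/3}`, with the average of `|w - c|` over `B` at most `ℓ`, the function
`|w - c|` is controlled by the oscillation of `w` on `B`. -/
theorem setIntegral_superlevel_le_oscillation {w : X → ℝ} {B : Set X} (hB : MeasurableSet B)
    (hB0 : 0 < μ.real B) (hBfin : μ B ≠ ⊤) (hwm : Measurable w) (hw : IntegrableOn w B μ)
    {c ℓ : ℝ} (h : ∫ z in B, |w z - c| ∂μ ≤ ℓ * μ.real B) :
    ∫ z in B ∩ {z | 4 / 3 * ℓ < |w z - c|}, |w z - c| ∂μ ≤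
      4 * ∫ z in B, |w z - ⨍ y in B, w y ∂μ| ∂μ := by
  have : IsFiniteMeasure (μ.restrict B) := isFiniteMeasure_restrict.2 hBfin
  set a := ⨍ y in B, w y ∂μ with ha
  have hac : |a - c| ≤ ℓ :=
    le_of_mul_le_mul_right ((abs_setAverage_sub_le hB0 hBfin hw c).trans h) hB0
  have hS : MeasurableSet {z | 4 / 3 * ℓ < |w z - c|} :=
    measurableSet_lt measurable_const ((hwm.sub_const c).abs)
  have hI : ∀ b : ℝ, IntegrableOn (fun z => |w z - b|) B μ := fun b =>
    (hw.sub (integrable_const b)).abs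
  rw [← integral_const_mul]
  calc _ ≤ ∫ z in B ∩ {z | 4 / 3 * ℓ < |w z - c|}, 4 * |w z - a| ∂μ := by
        refine setIntegral_mono_on ((hI c).mono_set inter_subset_left)
          (IntegrableOn.mono_set ((hI a).const_mul 4) inter_subset_left) (hB.inter hS) ?_
        intro z hz
        -- Here `ℓ < (3/4)|w z - c|`, so `|w z - a| ≥ |w z - c| - ℓ` exceeds a quarter of `|w z -
        -- c|`.
        have h1 : 4 / 3 * ℓ < |w z - c| := hz.2
        have h2 : |w z - c| ≤ |w z - a| + |a - c| := abs_sub_le _ _ _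
        linarith
    _ ≤ _ := setIntegral_mono_set ((hI a).const_mul 4)
        (ae_of_all _ fun _ => by positivity) inter_subset_left.eventuallyLE

end Superlevel

theorem withDensity_apply_eq_ofReal_integral {X : Type*} [MeasurableSpace X] {μ : Measure X}
    {f : X → ℝ} (hf0 : ∀ y, 0 ≤ f y) {A : Set X} (hA : MeasurableSet A)
    (hfi : IntegrableOn f A μ) :
    μ.withDensity (fun z => ENNReal.ofReal (f z)) A = ENNReal.ofReal (∫ z in A, f z ∂μ) := by
  rw [withDensity_apply _ hA, ofReal_integral_eq_lintegral_ofReal hfi (ae_of_all _ hf0)]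

/-! ### The good-λ inequality. -/

section GoodLambda

variable {X : Type*} [MetricSpace X] [MeasurableSpace X] [BorelSpace X] {μ : Measure X}

/-- The good-λ estimate on a single stopping ball. -/
theorem setIntegral_superlevel_le_of_stopping (hμ : IsDoubling μ) {cμ D : ℝ}
    (hcD : HasDoublingConstants μ cμ D) {τ ε : ℝ} (hτ : 1 ≤ τ) (hε : 0 < ε) {w : X → ℝ}
    (hwm : Measurable w) (hwi : Integrable w μ) {S : Set X}
    (hGR : WeakGurovReshetnyakOn μ τ ε w S) {c ℓ : ℝ} (hc : 0 ≤ c) (hℓ : 0 < ℓ) {y : X} {s : ℝ}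
    (hs : 0 < s) (hsub : ball y (τ * (6 * s)) ⊆ S)
    (hlt : ℓ * μ.real (ball y s) < ∫ z in ball y s, |w z - c| ∂μ)
    (hle : ∀ t, 2 * s ≤ t → t ≤ τ * (6 * s) →
      ∫ z in ball y t, |w z - c| ∂μ ≤ ℓ * μ.real (ball y t)) :
    ∫ z in ball y (6 * s) ∩ {z | 4 / 3 * ℓ < |w z - c|}, |w z - c| ∂μ ≤
      12 * cμ * 6 ^ D * (ε * (c / ℓ + 1)) *
        ∫ z in ball y s ∩ {z | 2 / 3 * ℓ < |w z - c|}, |w z - c| ∂μ := by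
  have : Nonempty X := ⟨y⟩
  have h6s : 6 * s ≤ τ * (6 * s) := by nlinarith
  have hcμ := hcD.one_le hμ
  have hB6 := hμ.measureReal_ball_pos y (r := 6 * s) (by positivity)
  have hBτ := hμ.measureReal_ball_pos y (r := τ * (6 * s)) (by positivity)
  have hB := hμ.measureReal_ball_pos y hs
  have hfi : ∀ r, IntegrableOn (fun z => |w z - c|) (ball y r) μ := fun r => by
    have : IsFiniteMeasure (μ.restrict (ball y r)) :=
      isFiniteMeasure_restrict.2 (hμ.measure_ball_ne_top _ _)
    exact (hwi.integrableOn.sub (integrable_const c)).abs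
  have h1 := mul_measureReal_le_setIntegral_superlevel isOpen_ball.measurableSet
    (hμ.measure_ball_ne_top y s) (hwm.sub_const c).abs (hfi s) hlt hℓ.le
  have h2 := setIntegral_superlevel_le_oscillation isOpen_ball.measurableSet hB6
    (hμ.measure_ball_ne_top y _) hwm hwi.integrableOn (hle (6 * s) (by linarith) h6s)
  have h3 := hGR y (6 * s) (by positivity) hsub
  have h4 : ⨍ z in ball y (τ * (6 * s)), w z ∂μ ≤ c + ℓ := by
    have h := le_of_mul_le_mul_right ((abs_setAverage_sub_le hBτ (hμ.measure_ball_ne_top y _)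
      hwi.integrableOn c).trans (hle (τ * (6 * s)) (by linarith) le_rfl)) hBτ
    linarith [(abs_le.1 h).2]
  have h5 := hcD.measureReal_ball_le hμ hs (by linarith) (ball_subset_ball (x := y)
    (show s ≤ 6 * s by linarith))
  rw [mul_div_assoc, div_self hs.ne', mul_one] at h5
  rw [setAverage_eq, smul_eq_mul, inv_mul_le_iff₀ hB6] at h3
  set I := ∫ z in ball y s ∩ {z | 2 / 3 * ℓ < |w z - c|}, |w z - c| ∂μ
  have hK : (0 : ℝ) < cμ * 6 ^ D := by positivity
  calc _ ≤ _ := h2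
    _ ≤ 4 * (μ.real (ball y (6 * s)) * (ε * (c + ℓ))) := by gcongr; exact h3.trans (by gcongr)
    _ ≤ 4 * (cμ * 6 ^ D * μ.real (ball y s) * (ε * (c + ℓ))) := by gcongr
    _ = 12 * cμ * 6 ^ D * (ε * (c / ℓ + 1)) * (ℓ / 3 * μ.real (ball y s)) := by
        field_simp; ring
    _ ≤ _ := by gcongr

/-- Good-λ inequality for `|w - c|`, with a slight enlargement of the ball. -/
theorem withDensity_superlevel_le (hμ : IsDoubling μ) {cμ D : ℝ}
    (hcD : HasDoublingConstants μ cμ D) {τ ε : ℝ} (hτ : 1 ≤ τ) (hε : 0 < ε) {w : X → ℝ}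
    (hwm : Measurable w) (hwi : Integrable w μ) {S : Set X}
    (hGR : WeakGurovReshetnyakOn μ τ ε w S) {x : X} {R : ℝ} (hRS : ball x R ⊆ S)
    {c ℓ δ ρ : ℝ} (hc : 0 ≤ c) (hℓ : 0 < ℓ) (hδ : 0 < δ) (hρ : ρ + τ * (6 * δ) ≤ R)
    (hlarge : ∀ y ∈ ball x ρ, ∀ s, δ ≤ s → s ≤ τ * (6 * δ) →
      ∫ z in ball y s, |w z - c| ∂μ ≤ ℓ * μ.real (ball y s)) :
    μ.withDensity (fun z => ENNReal.ofReal |w z - c|)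
        (ball x ρ ∩ {z | 4 / 3 * ℓ < |w z - c|}) ≤
      ENNReal.ofReal (12 * cμ * 6 ^ D * (ε * (c / ℓ + 1))) *
        μ.withDensity (fun z => ENNReal.ofReal |w z - c|)
          (ball x (ρ + δ) ∩ {z | 2 / 3 * ℓ < |w z - c|}) := by
  set ν := μ.withDensity (fun z => ENNReal.ofReal |w z - c|) with hν
  set q := 12 * cμ * 6 ^ D * (ε * (c / ℓ + 1)) with hq
  have : Nonempty X := ⟨x⟩
  have hcμ := hcD.one_le hμ
  have hq0 : 0 ≤ q := by positivity
  have hfm : Measurable fun z => |w z - c| := (hwm.sub_const c).abs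
  have hfi : ∀ y r, IntegrableOn (fun z => |w z - c|) (ball y r) μ := fun y r => by
    have : IsFiniteMeasure (μ.restrict (ball y r)) :=
      isFiniteMeasure_restrict.2 (hμ.measure_ball_ne_top _ _)
    exact (hwi.integrableOn.sub (integrable_const c)).abs
  have hball : ∀ y ∈ ball x ρ, ∀ s ≤ τ * (6 * δ), ball y s ⊆ ball x R := fun y hy s hs => by
    refine ball_subset_ball' ?_
    rw [mem_ball] at hy
    linarith
  have hδτ : 6 * δ ≤ τ * (6 * δ) := by nlinarith
  -- The constant `c` need not be integrable over `X`, so `|w - c|` is cut off to the `R`-ball,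
  -- which contains all the small balls involved.
  have hLeb := hμ.ae_eventually_lt_setIntegral_ball
    ((integrable_indicator_iff isOpen_ball.measurableSet).2 (hfi x R))
  set G : Set X := {y | ∀ ℓ < (ball x R).indicator (fun z => |w z - c|) y,
    ∀ᶠ s in 𝓝[>] (0 : ℝ), ℓ * μ.real (ball y s) <
      ∫ z in ball y s, (ball x R).indicator (fun z => |w z - c|) z ∂μ} with hG
  set E := ball x ρ ∩ {z | 4 / 3 * ℓ < |w z - c|} with hE
  have hball_stop : ∀ y ∈ E ∩ G, ∃ s, 0 < s ∧ s ≤ δ ∧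
      (ℓ * μ.real (ball y s) < ∫ z in ball y s, |w z - c| ∂μ) ∧
      ∀ t, 2 * s ≤ t → t ≤ δ → ¬ (ℓ * μ.real (ball y t) < ∫ z in ball y t, |w z - c| ∂μ) := by
    rintro y ⟨⟨hyρ, hyℓ⟩, hyG⟩
    apply exists_maximal_up_to_two
    have hyR : y ∈ ball x R := hball y hyρ (6 * δ) hδτ (mem_ball_self (by positivity))
    have hev := hyG ℓ (by
      rw [indicator_of_mem hyR]
      have : 4 / 3 * ℓ < |w y - c| := hyℓ
      linarith)
    obtain ⟨s, hs, hs0, hsδ⟩ := (hev.and (Ioc_mem_nhdsGT hδ)).exists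
    refine ⟨s, hs0, hsδ, hs.trans_eq ?_⟩
    refine setIntegral_congr_fun isOpen_ball.measurableSet fun z hz => ?_
    exact indicator_of_mem (hball y hyρ s (by linarith) hz) _
  choose! s hs0 hsδ hslt hsle using hball_stop
  obtain ⟨u, huE, hu, hdisj, hcov⟩ := hμ.exists_vitali_ball (E ∩ G) s δ
    fun y hy => ⟨hs0 y hy, hsδ y hy⟩
  have hmeas : ∀ t : ℝ, MeasurableSet {z | t < |w z - c|} := fun t =>
    measurableSet_lt measurable_const hfm
  have hone : ∀ y ∈ u, ν (ball y (6 * s y) ∩ {z | 4 / 3 * ℓ < |w z - c|}) ≤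
      ENNReal.ofReal q * ν (ball y (s y) ∩ {z | 2 / 3 * ℓ < |w z - c|}) := by
    intro y hy
    have hyE := huE hy
    have hs6 : τ * (6 * s y) ≤ τ * (6 * δ) := by
      have := hsδ y hyE
      gcongr
    rw [hν, withDensity_apply_eq_ofReal_integral (fun _ => abs_nonneg _)
        (isOpen_ball.measurableSet.inter (hmeas _)) ((hfi _ _).mono_set inter_subset_left),
      withDensity_apply_eq_ofReal_integral (fun _ => abs_nonneg _)
        (isOpen_ball.measurableSet.inter (hmeas _)) ((hfi _ _).mono_set inter_subset_left),
      ← ENNReal.ofReal_mul hq0]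
    refine ENNReal.ofReal_le_ofReal ?_
    refine setIntegral_superlevel_le_of_stopping hμ hcD hτ hε hwm hwi hGR hc hℓ (hs0 y hyE)
      ((hball y hyE.1.1 _ hs6).trans hRS) (hslt y hyE) fun t ht ht' => ?_
    -- Near-maximality controls radii up to `δ`; `hlarge` takes over beyond.
    rcases le_total t δ with h | h
    · exact not_lt.1 (hsle y hyE t ht h)
    · exact hlarge y hyE.1.1 t h (ht'.trans hs6)
  have hae : E =ᵐ[ν] (E ∩ G : Set X) := by
    have hGae : ∀ᵐ y ∂ν, y ∈ G := (withDensity_absolutelyContinuous μ _).ae_le hLeb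
    filter_upwards [hGae] with y hy
    exact propext ⟨fun h => ⟨h, hy⟩, fun h => h.1⟩
  calc ν E = ν (E ∩ G) := measure_congr hae
    _ ≤ ν (⋃ y ∈ u, ball y (6 * s y) ∩ {z | 4 / 3 * ℓ < |w z - c|}) := by
        refine measure_mono fun y hy => ?_
        obtain ⟨b, hb, hyb⟩ := mem_iUnion₂.1 (hcov hy)
        exact mem_iUnion₂.2 ⟨b, hb, hyb, hy.1.2⟩
    _ ≤ ∑' y : u, ν (ball (y : X) (6 * s y) ∩ {z | 4 / 3 * ℓ < |w z - c|}) :=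
        measure_biUnion_le ν hu _
    _ ≤ ∑' y : u, ENNReal.ofReal q * ν (ball (y : X) (s y) ∩ {z | 2 / 3 * ℓ < |w z - c|}) :=
        ENNReal.tsum_le_tsum fun y => hone y y.2
    _ = ENNReal.ofReal q * ν (⋃ y ∈ u, ball y (s y) ∩ {z | 2 / 3 * ℓ < |w z - c|}) := by
        rw [ENNReal.tsum_mul_left, measure_biUnion hu
          (hdisj.mono fun y => inter_subset_left)
          fun y _ => isOpen_ball.measurableSet.inter (hmeas _)]
    _ ≤ _ := by
        gcongr
        refine iUnion₂_subset fun y hy => inter_subset_inter_left _ (ball_subset_ball' ?_)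
        have h1 := hsδ y (huE hy)
        have h2 := mem_ball.1 (huE hy).1.1
        linarith

end GoodLambda

/-! ### Summation over dyadic levels. -/

/-- Geometric decay of the superlevel sets of `f` at dyadic levels gives an `L^p` bound. -/
theorem lintegral_rpow_le_of_superlevel_decay {X : Type*} [MeasurableSpace X] {μ : Measure X}
    {f : X → ℝ} (hf : Measurable f) (hf0 : ∀ y, 0 ≤ f y) {A : Set X} (hA : MeasurableSet A)
    {p h : ℝ} (hp : 1 ≤ p) (hh : 0 < h) {M : ENNReal}
    (hM : μ.withDensity (fun z => ENNReal.ofReal (f z)) A ≤ M)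
    (hdecay : ∀ k : ℕ, μ.withDensity (fun z => ENNReal.ofReal (f z)) (A ∩ {z | 2 ^ k * h < f z}) ≤
      ENNReal.ofReal (((2 : ℝ) ^ (-p)) ^ k) * M) :
    ∫⁻ z in A, ENNReal.ofReal (f z ^ p) ∂μ ≤ ENNReal.ofReal (h ^ (p - 1) * (1 + 2 ^ p)) * M := by
  set ν := μ.withDensity (fun z => ENNReal.ofReal (f z)) with hν
  have hmeas : ∀ k : ℕ, MeasurableSet {z | 2 ^ k * h < f z} := fun k =>
    measurableSet_lt measurable_const hf
  have hp0 : 0 ≤ p - 1 := by linarith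
  have e1 : ∫⁻ z in A, ENNReal.ofReal (f z ^ p) ∂μ =
      ∫⁻ z in A, ENNReal.ofReal (f z ^ (p - 1)) ∂ν := by
    rw [hν, setLIntegral_withDensity_eq_setLIntegral_mul _ hf.ennreal_ofReal
      (hf.pow_const _).ennreal_ofReal hA]
    refine lintegral_congr fun z => ?_
    rw [Pi.mul_apply, ← ENNReal.ofReal_mul (hf0 z)]
    congr 1
    rcases (hf0 z).eq_or_lt with hz | hz
    · rw [← hz, Real.zero_rpow (by linarith), zero_mul]
    · nth_rewrite 2 [← Real.rpow_one (f z)]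
      rw [← Real.rpow_add hz]
      ring_nf
  have hpt : ∀ z, ENNReal.ofReal (f z ^ (p - 1)) ≤ ENNReal.ofReal (h ^ (p - 1)) +
      ∑' k : ℕ, {z | 2 ^ k * h < f z}.indicator
        (fun _ => ENNReal.ofReal ((2 ^ (k + 1) * h) ^ (p - 1))) z := by
    intro z
    rcases le_or_gt (f z) h with hz | hz
    · exact le_add_right
        (ENNReal.ofReal_le_ofReal (Real.rpow_le_rpow (hf0 z) hz hp0))
    · obtain ⟨k, hk, hk'⟩ := exists_nat_pow_near (x := f z / h) (y := 2)
        ((one_le_div hh).2 hz.le) one_lt_two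
      rw [div_lt_iff₀ hh] at hk'
      rw [le_div_iff₀ hh] at hk
      -- The superlevel sets are strict: a point with `f z = 2^k h` misses the `k`-th one and is
      -- absorbed by the term of index `k - 1`, whose weight is exactly `(2^k h)^(p-1)`.
      rcases hk.eq_or_lt with heq | hlt
      · cases k with
        | zero => simp only [pow_zero, one_mul] at heq; exact absurd heq hz.ne
        | succ k =>
          refine le_add_left (le_trans ?_ (ENNReal.le_tsum k))
          rw [indicator_of_mem]
          · rw [heq]
          · change 2 ^ k * h < f z
            rw [← heq, pow_succ]
            nlinarith [pow_pos (two_pos (α := ℝ)) k, mul_pos (pow_pos (two_pos (α := ℝ)) k) hh]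
      · refine le_add_left (le_trans ?_ (ENNReal.le_tsum k))
        rw [indicator_of_mem (show z ∈ {z | 2 ^ k * h < f z} from hlt)]
        exact ENNReal.ofReal_le_ofReal (Real.rpow_le_rpow (hf0 z) hk'.le hp0)
  -- Growth `2^(k(p-1))` against decay `2^(-pk)` leaves a geometric series of ratio `1/2`.
  have hterm : ∀ k : ℕ, ((2 : ℝ) ^ (k + 1) * h) ^ (p - 1) * ((2 : ℝ) ^ (-p)) ^ k =
      h ^ (p - 1) * 2 ^ (p - 1) * (1 / 2) ^ k := by
    intro k
    rw [Real.mul_rpow (by positivity) hh.le, ← Real.rpow_natCast 2 (k + 1),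
      ← Real.rpow_natCast (2 ^ (-p)) k, ← Real.rpow_mul zero_le_two, ← Real.rpow_mul zero_le_two,
      one_div, inv_pow, ← Real.rpow_natCast 2 k, ← Real.rpow_neg zero_le_two]
    have : (2 : ℝ) ^ (((k + 1 : ℕ) : ℝ) * (p - 1)) * 2 ^ (-p * k) =
        2 ^ (p - 1) * 2 ^ (-(k : ℝ)) := by
      rw [← Real.rpow_add two_pos, ← Real.rpow_add two_pos]
      congr 1
      push_cast
      ring
    linear_combination h ^ (p - 1) * this
  rw [e1]
  calc ∫⁻ z in A, ENNReal.ofReal (f z ^ (p - 1)) ∂ν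
      ≤ ∫⁻ z in A, (ENNReal.ofReal (h ^ (p - 1)) +
      ∑' k : ℕ, {z | 2 ^ k * h < f z}.indicator
        (fun _ => ENNReal.ofReal ((2 ^ (k + 1) * h) ^ (p - 1))) z) ∂ν := lintegral_mono hpt
    _ = ENNReal.ofReal (h ^ (p - 1)) * ν A +
        ∑' k : ℕ, ENNReal.ofReal ((2 ^ (k + 1) * h) ^ (p - 1)) *
          ν (A ∩ {z | 2 ^ k * h < f z}) := by
        rw [lintegral_add_left measurable_const, setLIntegral_const, lintegral_tsum
          fun k => (measurable_const.indicator (hmeas k)).aemeasurable]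
        congr 1
        refine tsum_congr fun k => ?_
        rw [lintegral_indicator (hmeas k), Measure.restrict_restrict (hmeas k), setLIntegral_const,
          inter_comm]
    _ ≤ ENNReal.ofReal (h ^ (p - 1)) * M +
        ∑' k : ℕ, ENNReal.ofReal (h ^ (p - 1) * 2 ^ (p - 1) * (1 / 2) ^ k) * M := by
        refine add_le_add (by gcongr) (ENNReal.tsum_le_tsum fun k => ?_)
        calc _ ≤ ENNReal.ofReal ((2 ^ (k + 1) * h) ^ (p - 1)) *
              (ENNReal.ofReal (((2 : ℝ) ^ (-p)) ^ k) * M) := mul_le_mul_right (hdecay k) _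
          _ = _ := by
            rw [← mul_assoc, ← ENNReal.ofReal_mul (by positivity), hterm]
    _ = _ := by
        rw [ENNReal.tsum_mul_right, ← add_mul, ← ENNReal.ofReal_tsum_of_nonneg
          (fun k => by positivity) (summable_geometric_two.mul_left _), tsum_mul_left,
          tsum_geometric_two, ← ENNReal.ofReal_add (by positivity) (by positivity)]
        congr 2
        have : (2 : ℝ) ^ p = 2 ^ (p - 1) * 2 := by
          rw [← Real.rpow_add_one two_ne_zero]; ring_nf
        rw [this]
        ring

/-! ### Iteration on shrinking balls. -/

section Decay

variable {X : Type*} [MetricSpace X] [MeasurableSpace X] [BorelSpace X] {μ : Measure X}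

/-- Iterating the good-λ inequality: decay of the superlevel sets of `|w - w_{(1+η)B}|` on `B`. -/
theorem withDensity_superlevel_decay (hμ : IsDoubling μ) {cμ D : ℝ}
    (hcD : HasDoublingConstants μ cμ D) {τ ε : ℝ} (hτ : 1 ≤ τ) (hε : 0 < ε) {w : X → ℝ}
    (hwm : Measurable w) (hw0 : ∀ y, 0 ≤ w y) (hwi : Integrable w μ) {S : Set X}
    (hGR : WeakGurovReshetnyakOn μ τ ε w S) {x : X} {r η : ℝ} (hr : 0 < r) (hη : 0 < η)
    (hS : ball x (τ * ((1 + η) * r)) ⊆ S) {V L q : ℝ} (hV : 0 < V)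
    (hWV : ⨍ z in ball x (τ * ((1 + η) * r)), w z ∂μ ≤ V)
    (hL : cμ * ((1 + η) * (1 / (1 - 2 ^ (-(1 / D))) + 6 * τ) / η) ^ D ≤ L)
    (hq : 12 * cμ * 6 ^ D * (cμ * τ ^ D / L + ε) ≤ q) (k : ℕ) :
    μ.withDensity (fun z => ENNReal.ofReal |w z - ⨍ y in ball x ((1 + η) * r), w y ∂μ|)
        (ball x r ∩ {z | 2 ^ k * (2 / 3 * (L * (ε * V))) <
          |w z - ⨍ y in ball x ((1 + η) * r), w y ∂μ|}) ≤
      ENNReal.ofReal (q ^ k) *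
        μ.withDensity (fun z => ENNReal.ofReal |w z - ⨍ y in ball x ((1 + η) * r), w y ∂μ|)
          (ball x ((1 + η) * r)) := by
  have : Nonempty X := ⟨x⟩
  have hcμ := hcD.one_le hμ
  have hD := hcD.1
  set R := (1 + η) * r with hR
  have hR0 : 0 < R := by positivity
  -- As `σ^D = 1/2`, shrinking the stopping scale by `σ` costs a factor 2 in the doubling bound,
  -- which the doubled level absorbs.
  set σ : ℝ := 2 ^ (-(1 / D)) with hσ
  have hσ0 : 0 < σ := by positivity
  have hσ1 : σ < 1 := by
    rw [hσ]
    exact Real.rpow_lt_one_of_one_lt_of_neg one_lt_two (by simpa using hD)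
  have hσ1' : 0 < 1 - σ := by linarith
  have hσD : σ ^ D = 1 / 2 := by
    rw [hσ, ← Real.rpow_mul zero_le_two, neg_mul, one_div_mul_cancel hD.ne', Real.rpow_neg_one]
    norm_num
  -- Chosen so that with `b = R / a` all increments `b σ^k`, plus the margin `6τb` for dilated
  -- stopping balls, add up to `R - r = ηr`.
  set a := (1 + η) * (1 / (1 - σ) + 6 * τ) / η with ha
  have ha0 : 0 < a := by positivity
  have hL0 : 0 < L := lt_of_lt_of_le (by positivity) hL
  have hq0 : 0 ≤ q := le_trans (by positivity) hq
  set c := ⨍ y in ball x R, w y ∂μ with hc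
  have hc0 : 0 ≤ c := by
    rw [hc, setAverage_eq, smul_eq_mul]
    exact mul_nonneg (inv_nonneg.2 measureReal_nonneg) (integral_nonneg hw0)
  have hτR : R ≤ τ * R := by nlinarith
  have hBR := hμ.measureReal_ball_pos x hR0
  have hBτR := hμ.measureReal_ball_pos x (r := τ * R) (by positivity)
  have hfi : ∀ y s, IntegrableOn (fun z => |w z - c|) (ball y s) μ := fun y s => by
    have : IsFiniteMeasure (μ.restrict (ball y s)) :=
      isFiniteMeasure_restrict.2 (hμ.measure_ball_ne_top _ _)
    exact (hwi.integrableOn.sub (integrable_const c)).abs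
  have hcV : c ≤ cμ * τ ^ D * V := by
    rw [hc, setAverage_eq, smul_eq_mul, inv_mul_le_iff₀ hBR]
    rw [setAverage_eq, smul_eq_mul, inv_mul_le_iff₀ hBτR] at hWV
    have h1 := hcD.measureReal_ball_le hμ hR0 hτR (ball_subset_ball (x := x) hτR)
    rw [mul_div_assoc, div_self hR0.ne', mul_one] at h1
    calc ∫ z in ball x R, w z ∂μ ≤ ∫ z in ball x (τ * R), w z ∂μ :=
          setIntegral_mono_set hwi.integrableOn (ae_of_all _ hw0)
            (ball_subset_ball hτR).eventuallyLE
      _ ≤ _ := hWV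
      _ ≤ cμ * τ ^ D * μ.real (ball x R) * V := by gcongr
      _ = _ := by ring
  have hosc : ∫ z in ball x R, |w z - c| ∂μ ≤ μ.real (ball x R) * (ε * V) := by
    have h1 := hGR x R hR0 hS
    rw [setAverage_eq, smul_eq_mul, inv_mul_le_iff₀ hBR] at h1
    exact h1.trans (by gcongr)
  set ν := μ.withDensity (fun z => ENNReal.ofReal |w z - c|) with hν
  set b := R / a with hb
  have hb0 : 0 < b := by positivity
  have hbR : r + b / (1 - σ) + 6 * τ * b = R := by
    have : b * (1 / (1 - σ) + 6 * τ) = η * r := by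
      rw [hb, ha, hR]; field_simp
    rw [hR]
    linear_combination this
  have key : ∀ k : ℕ, ν (ball x (r + b / (1 - σ) * σ ^ k) ∩
      {z | 2 ^ k * (2 / 3 * (L * (ε * V))) < |w z - c|}) ≤
        ENNReal.ofReal (q ^ k) * ν (ball x R) := by
    intro k
    induction k with
    | zero =>
      simp only [pow_zero, ENNReal.ofReal_one, one_mul, mul_one]
      refine measure_mono (inter_subset_left.trans (ball_subset_ball ?_))
      have : 0 < 6 * τ * b := by positivity
      linarith
    | succ k ih =>
      set ℓ := 2 ^ k * (L * (ε * V)) with hℓ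
      have hℓ0 : 0 < ℓ := by positivity
      have hσk : σ ^ k ≤ 1 := pow_le_one₀ hσ0.le hσ1.le
      have hσk0 : 0 < σ ^ k := by positivity
      have hρ1 : r + b / (1 - σ) * σ ^ (k + 1) + b * σ ^ k = r + b / (1 - σ) * σ ^ k := by
        rw [pow_succ]
        field_simp
        ring
      have hρ2 : r + b / (1 - σ) * σ ^ (k + 1) + τ * (6 * (b * σ ^ k)) ≤ R := by
        have h1 : b / (1 - σ) * σ ^ (k + 1) ≤ b / (1 - σ) :=
          mul_le_of_le_one_right (by positivity) (pow_le_one₀ hσ0.le hσ1.le)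
        have h2 : 6 * τ * b * σ ^ k ≤ 6 * τ * b := mul_le_of_le_one_right (by positivity) hσk
        linarith
      have hpow : (R / (b * σ ^ k)) ^ D = a ^ D * 2 ^ k := by
        have h1 : R / (b * σ ^ k) = a * (σ⁻¹) ^ k := by
          rw [hb, inv_pow]; field_simp
        rw [h1, Real.mul_rpow ha0.le (by positivity), ← Real.rpow_natCast (σ⁻¹) k,
          ← Real.rpow_mul (by positivity), mul_comm (k : ℝ), Real.rpow_mul (by positivity),
          Real.inv_rpow hσ0.le, hσD, Real.rpow_natCast]
        norm_num
      have hgood := withDensity_superlevel_le (δ := b * σ ^ k)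
        (ρ := r + b / (1 - σ) * σ ^ (k + 1)) (ℓ := ℓ) hμ hcD hτ hε hwm hwi hGR
        ((ball_subset_ball hτR).trans hS) hc0 hℓ0 (by positivity) hρ2 (by
          intro y hy s hs hs'
          have hs0 : 0 < s := lt_of_lt_of_le (by positivity) hs
          have hsub : ball y s ⊆ ball x R := by
            refine ball_subset_ball' ?_
            rw [mem_ball] at hy
            linarith
          have hsR : s ≤ R := by
            have : 0 < b / (1 - σ) * σ ^ (k + 1) := by positivity
            linarith
          calc ∫ z in ball y s, |w z - c| ∂μ ≤ ∫ z in ball x R, |w z - c| ∂μ :=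
                setIntegral_mono_set (hfi x R) (ae_of_all _ fun _ => abs_nonneg _)
                  hsub.eventuallyLE
            _ ≤ μ.real (ball x R) * (ε * V) := hosc
            _ ≤ cμ * (R / s) ^ D * μ.real (ball y s) * (ε * V) := by
                gcongr
                exact hcD.measureReal_ball_le hμ hs0 hsR hsub
            _ ≤ cμ * (R / (b * σ ^ k)) ^ D * μ.real (ball y s) * (ε * V) := by gcongr
            _ = cμ * a ^ D * 2 ^ k * (ε * V) * μ.real (ball y s) := by rw [hpow]; ring
            _ ≤ L * 2 ^ k * (ε * V) * μ.real (ball y s) := by gcongr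
            _ = ℓ * μ.real (ball y s) := by rw [hℓ]; ring)
      rw [hρ1] at hgood
      have e1 : (2 : ℝ) ^ (k + 1) * (2 / 3 * (L * (ε * V))) = 4 / 3 * ℓ := by
        rw [hℓ, pow_succ]; ring
      have e2 : (2 : ℝ) ^ k * (2 / 3 * (L * (ε * V))) = 2 / 3 * ℓ := by rw [hℓ]; ring
      rw [e1]
      rw [e2] at ih
      have hqk : 12 * cμ * 6 ^ D * (ε * (c / ℓ + 1)) ≤ q := by
        refine le_trans ?_ hq
        -- The factor `ε` in the level cancels the one in front, so this term is made small by `L`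
        -- alone.
        have h1 : ε * (c / ℓ) ≤ cμ * τ ^ D / L := by
          rw [mul_div_assoc', div_le_div_iff₀ hℓ0 hL0]
          have h2k : (1 : ℝ) ≤ 2 ^ k := one_le_pow₀ one_le_two
          calc ε * c * L ≤ ε * (cμ * τ ^ D * V) * L := by gcongr
            _ = cμ * τ ^ D * (1 * (L * (ε * V))) := by ring
            _ ≤ cμ * τ ^ D * ℓ := by rw [hℓ]; gcongr
        gcongr
        linarith
      calc _ ≤ _ := hgood
        _ ≤ ENNReal.ofReal q * (ENNReal.ofReal (q ^ k) * ν (ball x R)) := by gcongr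
        _ = _ := by rw [← mul_assoc, ← ENNReal.ofReal_mul hq0, pow_succ']
  refine le_trans (measure_mono (inter_subset_inter_left _ (ball_subset_ball ?_))) (key k)
  have : 0 < b / (1 - σ) * σ ^ k := by positivity
  linarith

end Decay

/-! ### From superlevel decay to `L^p` estimates. -/

theorem add_rpow_le_two_rpow_mul {a b p : ℝ} (ha : 0 ≤ a) (hb : 0 ≤ b) (hp : 0 ≤ p) :
    (a + b) ^ p ≤ 2 ^ p * (a ^ p + b ^ p) := by
  rw [mul_add]
  rcases le_total a b with h | h
  · have h1 : (a + b) ^ p ≤ (2 * b) ^ p := Real.rpow_le_rpow (by positivity) (by linarith) hp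
    rw [Real.mul_rpow zero_le_two hb] at h1
    have : 0 ≤ (2 : ℝ) ^ p * a ^ p := by positivity
    linarith
  · have h1 : (a + b) ^ p ≤ (2 * a) ^ p := Real.rpow_le_rpow (by positivity) (by linarith) hp
    rw [Real.mul_rpow zero_le_two ha] at h1
    have : 0 ≤ (2 : ℝ) ^ p * b ^ p := by positivity
    linarith

/-- Used with `f = |w - c|` twice: for `g = |w - w_B|`, `b = |w_B - c|`, `T = εW`, and for `g = w`,
`b = c`, `T = W`. -/
theorem setAverage_rpow_le_of_le_add {X : Type*} [MeasurableSpace X] {μ : Measure X}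
    {f g : X → ℝ} {B : Set X} (hB0 : 0 < μ.real B) (hBfin : μ B ≠ ⊤)
    (hf : Measurable f) (hg : Measurable g) (hf0 : ∀ y, 0 ≤ f y) (hg0 : ∀ y, 0 ≤ g y)
    {b p K K' T : ℝ} (hgf : ∀ y, g y ≤ f y + b) (hb : 0 ≤ b) (hp : 1 ≤ p) (hK : 0 ≤ K)
    (hK' : 0 ≤ K') (hT : 0 ≤ T) (hbT : b ≤ K' * T)
    (h : ∫⁻ y in B, ENNReal.ofReal (f y ^ p) ∂μ ≤ ENNReal.ofReal (K * T ^ p * μ.real B)) :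
    IntegrableOn (fun y => g y ^ p) B μ ∧
      (⨍ y in B, g y ^ p ∂μ) ^ (1 / p) ≤ 2 * (K + K' ^ p) ^ (1 / p) * T := by
  have : IsFiniteMeasure (μ.restrict B) := isFiniteMeasure_restrict.2 hBfin
  have hp0 : 0 ≤ p := by linarith
  have hfp0 : ∀ y, 0 ≤ f y ^ p := fun y => Real.rpow_nonneg (hf0 y) p
  have hfi : IntegrableOn (fun y => f y ^ p) B μ := by
    refine ⟨(hf.pow_const p).aestronglyMeasurable, ?_⟩
    rw [hasFiniteIntegral_iff_ofReal (ae_of_all _ hfp0)]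
    exact h.trans_lt ENNReal.ofReal_lt_top
  have hfle : ∫ y in B, f y ^ p ∂μ ≤ K * T ^ p * μ.real B := by
    rw [← ofReal_integral_eq_lintegral_ofReal hfi (ae_of_all _ hfp0)] at h
    exact (ENNReal.ofReal_le_ofReal_iff (by positivity)).1 h
  have hdom : ∀ y, g y ^ p ≤ 2 ^ p * (f y ^ p + b ^ p) := fun y =>
    (Real.rpow_le_rpow (hg0 y) (hgf y) hp0).trans (add_rpow_le_two_rpow_mul (hf0 y) hb hp0)
  have hdi : IntegrableOn (fun y => 2 ^ p * (f y ^ p + b ^ p)) B μ :=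
    Integrable.const_mul (Integrable.add hfi (integrable_const _)) _
  have hgi : IntegrableOn (fun y => g y ^ p) B μ := by
    refine Integrable.mono' hdi (hg.pow_const p).aestronglyMeasurable (ae_of_all _ fun y => ?_)
    rw [Real.norm_of_nonneg (Real.rpow_nonneg (hg0 y) p)]
    exact hdom y
  refine ⟨hgi, ?_⟩
  have hbp : b ^ p ≤ K' ^ p * T ^ p := by
    rw [← Real.mul_rpow hK' hT]
    exact Real.rpow_le_rpow hb hbT hp0
  have havg : ⨍ y in B, g y ^ p ∂μ ≤ (2 * T) ^ p * (K + K' ^ p) := by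
    rw [setAverage_eq, smul_eq_mul, inv_mul_le_iff₀ hB0]
    calc ∫ y in B, g y ^ p ∂μ ≤ ∫ y in B, 2 ^ p * (f y ^ p + b ^ p) ∂μ :=
          integral_mono hgi hdi hdom
      _ = 2 ^ p * (∫ y in B, f y ^ p ∂μ + μ.real B * b ^ p) := by
          rw [integral_const_mul, integral_add hfi (integrable_const _), setIntegral_const,
            smul_eq_mul]
      _ ≤ 2 ^ p * (K * T ^ p * μ.real B + μ.real B * (K' ^ p * T ^ p)) := by gcongr
      _ = _ := by rw [Real.mul_rpow zero_le_two hT]; ring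
  have havg0 : 0 ≤ ⨍ y in B, g y ^ p ∂μ := by
    rw [setAverage_eq, smul_eq_mul]
    exact mul_nonneg (inv_nonneg.2 measureReal_nonneg)
      (integral_nonneg fun y => Real.rpow_nonneg (hg0 y) p)
  calc _ ≤ ((2 * T) ^ p * (K + K' ^ p)) ^ (1 / p) :=
        Real.rpow_le_rpow havg0 havg (by positivity)
    _ = _ := by
        rw [Real.mul_rpow (by positivity) (by positivity), ← Real.rpow_mul (by positivity),
          mul_one_div_cancel (by linarith), Real.rpow_one]
        ring

section SelfImprovement

variable {X : Type*} [MetricSpace X] [MeasurableSpace X] [BorelSpace X] {μ : Measure X}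

/-- The subtracted constant is the mean over the enlarged ball, where the iteration starts. -/
theorem WeakGurovReshetnyakOn.exists_lintegral_rpow_le [Nonempty X] (hμ : IsDoubling μ) {cμ D : ℝ}
    (hcD : HasDoublingConstants μ cμ D) {τ η p : ℝ} (hτ : 1 ≤ τ) (hη : 0 < η) (hp : 1 ≤ p) :
    ∃ K : ℝ, 0 < K ∧ ∀ ε : ℝ, 0 < ε → 24 * cμ * 6 ^ D * ε * 2 ^ p ≤ 1 →
      ∀ w : X → ℝ, Measurable w → (∀ y, 0 ≤ w y) → Integrable w μ →
      ∀ S : Set X, WeakGurovReshetnyakOn μ τ ε w S → ∀ (x : X) (r : ℝ), 0 < r →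
        ball x (τ * ((1 + η) * r)) ⊆ S →
        ∫⁻ y in ball x r,
            ENNReal.ofReal (|w y - ⨍ z in ball x ((1 + η) * r), w z ∂μ| ^ p) ∂μ ≤
          ENNReal.ofReal (K * (ε * ⨍ y in ball x (τ * ((1 + η) * r)), w y ∂μ) ^ p *
            μ.real (ball x r)) := by
  have hcμ := hcD.one_le hμ
  have hD := hcD.1
  have hσ1 : 0 < 1 - (2 : ℝ) ^ (-(1 / D)) := by
    have := Real.rpow_lt_one_of_one_lt_of_neg one_lt_two (z := -(1 / D)) (by simpa using hD)
    linarith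
  -- The first summand keeps the means at large scales below the level; the second bounds the
  -- `L`-part of `q` by half of `2^(-p)`, the smallness of `ε` giving the other half.
  set L := cμ * ((1 + η) * (1 / (1 - 2 ^ (-(1 / D))) + 6 * τ) / η) ^ D +
    24 * cμ * 6 ^ D * (cμ * τ ^ D) * 2 ^ p with hL
  have hL1 : 24 * cμ * 6 ^ D * (cμ * τ ^ D) * 2 ^ p ≤ L := by
    rw [hL]
    exact le_add_of_nonneg_left (by positivity)
  have hL0 : 0 < L := lt_of_lt_of_le (by positivity) hL1
  refine ⟨(2 / 3 * L) ^ (p - 1) * (1 + 2 ^ p) * (cμ * (1 + η) ^ D), by positivity, ?_⟩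
  intro ε hε hεp w hwm hw0 hwi S hGR x r hr hS
  set R := (1 + η) * r with hR
  have hR0 : 0 < R := by positivity
  have hrR : r ≤ R := by nlinarith
  set c := ⨍ z in ball x R, w z ∂μ
  set W := ⨍ y in ball x (τ * R), w y ∂μ with hW
  have hW0 : 0 ≤ W := by
    rw [hW, setAverage_eq, smul_eq_mul]
    exact mul_nonneg (inv_nonneg.2 measureReal_nonneg) (integral_nonneg hw0)
  have hfm : Measurable fun z => |w z - c| := (hwm.sub_const c).abs
  have hq : 12 * cμ * 6 ^ D * (cμ * τ ^ D / L + ε) ≤ 2 ^ (-p) := by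
    have h2 : (0 : ℝ) < 2 ^ p := by positivity
    rw [Real.rpow_neg zero_le_two]
    have h3 : 12 * cμ * 6 ^ D * (cμ * τ ^ D / L) * 2 ^ p ≤ 1 / 2 := by
      rw [mul_div_assoc', div_mul_eq_mul_div, div_le_iff₀ hL0]
      linarith
    rw [le_inv_comm₀ (by positivity) h2, ← one_div, le_div_iff₀ (by positivity)]
    linarith
  have hBR := hμ.measureReal_ball_pos x hR0
  have hosc : ∫ z in ball x R, |w z - c| ∂μ ≤ μ.real (ball x R) * (ε * W) := by
    have h1 := hGR x R hR0 hS
    rwa [setAverage_eq, smul_eq_mul, inv_mul_le_iff₀ hBR] at h1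
  have hfi : IntegrableOn (fun z => |w z - c|) (ball x R) μ := by
    have : IsFiniteMeasure (μ.restrict (ball x R)) :=
      isFiniteMeasure_restrict.2 (hμ.measure_ball_ne_top _ _)
    exact (hwi.integrableOn.sub (integrable_const c)).abs
  have hmR := hcD.measureReal_ball_le hμ hr hrR (ball_subset_ball (x := x) hrR)
  rw [hR, mul_div_assoc, div_self hr.ne', mul_one, ← hR] at hmR
  -- Levels must be positive but `W` may vanish, so `W` is replaced by `V > W`, and `V` then tends
  -- to `W`.
  have hV : ∀ V, W < V → ∫⁻ y in ball x r, ENNReal.ofReal (|w y - c| ^ p) ∂μ ≤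
      ENNReal.ofReal ((2 / 3 * L) ^ (p - 1) * (1 + 2 ^ p) * (cμ * (1 + η) ^ D) * (ε * V) ^ p *
        μ.real (ball x r)) := by
    intro V hWV
    have hV0 : 0 < V := hW0.trans_lt hWV
    have h1 := lintegral_rpow_le_of_superlevel_decay (A := ball x r) hfm (fun _ => abs_nonneg _)
      isOpen_ball.measurableSet hp (show 0 < 2 / 3 * (L * (ε * V)) by positivity)
      (measure_mono (ball_subset_ball hrR))
      (withDensity_superlevel_decay hμ hcD hτ hε hwm hw0 hwi hGR hr hη hS hV0 hWV.le
        (le_add_of_nonneg_right (by positivity)) hq)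
    refine h1.trans ?_
    rw [withDensity_apply_eq_ofReal_integral (fun _ => abs_nonneg _) isOpen_ball.measurableSet
      hfi, ← ENNReal.ofReal_mul (by positivity)]
    refine ENNReal.ofReal_le_ofReal ?_
    have e : (ε * V) ^ p = (ε * V) ^ (p - 1) * (ε * V) := by
      rw [← Real.rpow_add_one (by positivity)]; ring_nf
    rw [← mul_assoc (2 / 3 : ℝ), Real.mul_rpow (by positivity) (by positivity), e]
    calc _ ≤ (2 / 3 * L) ^ (p - 1) * (ε * V) ^ (p - 1) * (1 + 2 ^ p) *
          (cμ * (1 + η) ^ D * μ.real (ball x r) * (ε * V)) := by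
          gcongr
          refine hosc.trans ?_
          gcongr
      _ = _ := by ring
  have hcont : Tendsto (fun V => ENNReal.ofReal ((2 / 3 * L) ^ (p - 1) * (1 + 2 ^ p) *
      (cμ * (1 + η) ^ D) * (ε * V) ^ p * μ.real (ball x r))) (𝓝[>] W)
      (𝓝 (ENNReal.ofReal ((2 / 3 * L) ^ (p - 1) * (1 + 2 ^ p) *
      (cμ * (1 + η) ^ D) * (ε * W) ^ p * μ.real (ball x r)))) := by
    refine ENNReal.tendsto_ofReal (Tendsto.mul_const _ (Tendsto.const_mul _ ?_))
    refine Tendsto.mono_left ?_ nhdsWithin_le_nhds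
    exact (Tendsto.const_mul ε tendsto_id).rpow_const (Or.inr (by linarith))
  refine ge_of_tendsto hcont ?_
  filter_upwards [self_mem_nhdsWithin] with V hV'
  exact hV V hV'

/-- Self-improvement for measurable, globally nonnegative and integrable weights. -/
theorem WeakGurovReshetnyakOn.exists_oscillation_and_reverse_holder [Nonempty X]
    (hμ : IsDoubling μ) {cμ D : ℝ}
    (hcD : HasDoublingConstants μ cμ D) {τ η p : ℝ} (hτ : 1 ≤ τ) (hη : 0 < η) (hp : 1 ≤ p) :
    ∃ C : ℝ, 0 < C ∧ ∀ ε : ℝ, 0 < ε → 24 * cμ * 6 ^ D * ε * 2 ^ p ≤ 1 →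
      ∀ w : X → ℝ, Measurable w → (∀ y, 0 ≤ w y) → Integrable w μ →
      ∀ S : Set X, WeakGurovReshetnyakOn μ τ ε w S → ∀ (x : X) (r : ℝ), 0 < r →
        ball x (τ * ((1 + η) * r)) ⊆ S →
        (IntegrableOn (fun y => |w y - ⨍ z in ball x r, w z ∂μ| ^ p) (ball x r) μ ∧
          (⨍ y in ball x r, |w y - ⨍ z in ball x r, w z ∂μ| ^ p ∂μ) ^ (1 / p) ≤
            C * ε * ⨍ y in ball x (τ * ((1 + η) * r)), w y ∂μ) ∧
        (IntegrableOn (fun y => w y ^ p) (ball x r) μ ∧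
          (⨍ y in ball x r, w y ^ p ∂μ) ^ (1 / p) ≤
            C * ⨍ y in ball x (τ * ((1 + η) * r)), w y ∂μ) := by
  have hcμ := hcD.one_le hμ
  have hD := hcD.1
  obtain ⟨K, hK, hmain⟩ := WeakGurovReshetnyakOn.exists_lintegral_rpow_le hμ hcD hτ hη hp
  refine ⟨2 * (K + (cμ * (1 + η) ^ D) ^ p) ^ (1 / p) + 2 * (K + (cμ * τ ^ D) ^ p) ^ (1 / p),
    by positivity, ?_⟩
  intro ε hε hεp w hwm hw0 hwi S hGR x r hr hS
  have hle := hmain ε hε hεp w hwm hw0 hwi S hGR x r hr hS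
  set R := (1 + η) * r with hR
  have hR0 : 0 < R := by positivity
  have hrR : r ≤ R := by nlinarith
  have hτR : R ≤ τ * R := by nlinarith
  set c := ⨍ z in ball x R, w z ∂μ with hc
  set W := ⨍ y in ball x (τ * R), w y ∂μ with hW
  have havg0 : ∀ s, 0 ≤ ⨍ z in ball x s, w z ∂μ := fun s => by
    rw [setAverage_eq, smul_eq_mul]
    exact mul_nonneg (inv_nonneg.2 measureReal_nonneg) (integral_nonneg hw0)
  have hW0 : 0 ≤ W := havg0 _
  have hBr := hμ.measureReal_ball_pos x hr
  have hBR := hμ.measureReal_ball_pos x hR0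
  have hBτR := hμ.measureReal_ball_pos x (r := τ * R) (by positivity)
  have hfin := hμ.measure_ball_ne_top x
  have hcb : c ≤ cμ * τ ^ D * W := by
    have h1 := hcD.measureReal_ball_le hμ hR0 hτR (ball_subset_ball (x := x) hτR)
    rw [mul_div_assoc, div_self hR0.ne', mul_one] at h1
    rw [hc, setAverage_eq, smul_eq_mul, inv_mul_le_iff₀ hBR]
    have h2 : ∫ z in ball x (τ * R), w z ∂μ = μ.real (ball x (τ * R)) * W := by
      rw [hW, setAverage_eq, smul_eq_mul]; field_simp
    calc ∫ z in ball x R, w z ∂μ ≤ ∫ z in ball x (τ * R), w z ∂μ :=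
          setIntegral_mono_set hwi.integrableOn (ae_of_all _ hw0)
            (ball_subset_ball hτR).eventuallyLE
      _ = _ := h2
      _ ≤ cμ * τ ^ D * μ.real (ball x R) * W := by gcongr
      _ = _ := by ring
  have hbb : |(⨍ z in ball x r, w z ∂μ) - c| ≤ cμ * (1 + η) ^ D * (ε * W) := by
    have h1 := hGR x R hR0 hS
    rw [setAverage_eq, smul_eq_mul, inv_mul_le_iff₀ hBR] at h1
    have h2 := hcD.measureReal_ball_le hμ hr hrR (ball_subset_ball (x := x) hrR)
    rw [hR, mul_div_assoc, div_self hr.ne', mul_one, ← hR] at h2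
    refine le_of_mul_le_mul_right ?_ hBr
    have : IsFiniteMeasure (μ.restrict (ball x R)) := isFiniteMeasure_restrict.2 (hfin _)
    calc _ ≤ ∫ z in ball x r, |w z - c| ∂μ := abs_setAverage_sub_le hBr (hfin _) hwi.integrableOn c
      _ ≤ ∫ z in ball x R, |w z - c| ∂μ :=
          setIntegral_mono_set (hwi.integrableOn.sub (integrable_const c)).abs
            (ae_of_all _ fun _ => abs_nonneg _) (ball_subset_ball hrR).eventuallyLE
      _ ≤ _ := h1
      _ ≤ cμ * (1 + η) ^ D * μ.real (ball x r) * (ε * W) := by gcongr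
      _ = _ := by ring
  -- Lets `εW` be replaced by `W` in the reverse Hölder bound.
  have hε1 : ε ≤ 1 := by
    have h6 : (1 : ℝ) ≤ 6 ^ D := Real.one_le_rpow (by norm_num) hD.le
    have h2 : (1 : ℝ) ≤ 2 ^ p := Real.one_le_rpow (by norm_num) (by linarith)
    have h3 : 1 ≤ 24 * cμ * 6 ^ D * 2 ^ p :=
      one_le_mul_of_one_le_of_one_le (one_le_mul_of_one_le_of_one_le (by linarith) h6) h2
    nlinarith
  have hfm : ∀ a, Measurable fun z => |w z - a| := fun a => (hwm.sub_const a).abs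
  have h1 := setAverage_rpow_le_of_le_add hBr (hfin r) (hfm c) (hfm (⨍ z in ball x r, w z ∂μ))
    (fun _ => abs_nonneg _) (fun _ => abs_nonneg _)
    (fun y => by rw [abs_sub_comm (⨍ z in ball x r, w z ∂μ) c]; exact abs_sub_le _ _ _)
    (abs_nonneg ((⨍ z in ball x r, w z ∂μ) - c)) hp hK.le
    (show 0 ≤ cμ * (1 + η) ^ D by positivity) (show 0 ≤ ε * W by positivity) hbb hle
  have h2 := setAverage_rpow_le_of_le_add hBr (hfin r) (hfm c) hwm
    (fun _ => abs_nonneg _) hw0 (fun y => by linarith [le_abs_self (w y - c)])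
    (havg0 R) hp hK.le (show 0 ≤ cμ * τ ^ D by positivity) hW0 hcb
    (hle.trans (ENNReal.ofReal_le_ofReal (by
      have : (ε * W) ^ p ≤ W ^ p := Real.rpow_le_rpow (by positivity)
        (mul_le_of_le_one_left hW0 hε1) (by linarith)
      gcongr)))
  refine ⟨⟨h1.1, h1.2.trans ?_⟩, ⟨h2.1, h2.2.trans ?_⟩⟩
  · rw [← mul_assoc]
    gcongr
    exact le_add_of_nonneg_right (by positivity)
  · gcongr
    exact le_add_of_nonneg_left (by positivity)

end SelfImprovement

/-! ### Threshold and exponent. -/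

section Exponent

variable {cμ D Cμ τ : ℝ}

theorem one_lt_exponentGR_base (hcμ : 1 ≤ cμ) (hD : 0 < D) : 1 < 2 * cμ * (max τ 3) ^ D := by
  have h3 : (1 : ℝ) ≤ (max τ 3) ^ D :=
    Real.one_le_rpow (le_trans (by norm_num) (le_max_right _ _)) hD.le
  nlinarith

theorem one_lt_exponentGR (hcμ : 1 ≤ cμ) (hD : 0 < D) (hCμ : 1 ≤ Cμ) (hτ : 1 ≤ τ) {ε : ℝ}
    (hε : 0 < ε) (hε' : ε < thresholdGR D Cμ τ) : 1 < exponentGR cμ D Cμ τ ε := by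
  have hbase := one_lt_exponentGR_base (τ := τ) hcμ hD
  rw [exponentGR, one_lt_div (Real.log_pos hbase)]
  refine Real.log_lt_log (by linarith) ?_
  -- Because of this identity, `ε₀` is exactly the value of `ε` at which the two logarithms in
  -- `p(ε)` agree.
  have hmm : min 1 (τ / 3) * max τ 3 = τ := by
    rcases le_total τ 3 with h | h
    · rw [max_eq_right h, min_eq_right (by linarith)]; ring
    · rw [max_eq_left h, min_eq_left (by linarith), one_mul]
  have hmmD : (min 1 (τ / 3)) ^ D * (max τ 3) ^ D = τ ^ D := by
    rw [← Real.mul_rpow (by positivity) (by positivity), hmm]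
  have hM : 0 < (max τ 3) ^ D := by positivity
  rw [thresholdGR, one_div_mul_eq_div, lt_div_iff₀ (by positivity)] at hε'
  have e : Cμ⁻¹ * cμ * τ ^ D * ε⁻¹ = cμ * τ ^ D / (Cμ * ε) := by field_simp
  rw [e, lt_div_iff₀ (by positivity), ← hmmD]
  calc _ = cμ * (max τ 3) ^ D * (ε * (2 * Cμ)) := by ring
    _ < cμ * (max τ 3) ^ D * (min 1 (τ / 3)) ^ D := by gcongr
    _ = _ := by ring

theorem tendsto_exponentGR_atTop (hcμ : 1 ≤ cμ) (hD : 0 < D) (hCμ : 1 ≤ Cμ) (hτ : 1 ≤ τ) :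
    Tendsto (fun ε : ℝ => exponentGR cμ D Cμ τ ε) (𝓝[>] 0) atTop := by
  refine Tendsto.atTop_div_const (Real.log_pos (one_lt_exponentGR_base hcμ hD)) ?_
  exact Real.tendsto_log_atTop.comp
    (tendsto_inv_nhdsGT_zero.const_mul_atTop (show 0 < Cμ⁻¹ * cμ * τ ^ D by positivity))

/-- Exponentiating `p < p(ε)` gives `(2 cμ max(τ,3)^D)^p < cμ τ^D / (Cμ ε)`; the left side is at
least `2^p cμ τ^D` since `p ≥ 1`. -/
theorem mul_two_rpow_lt_one_of_lt_exponentGR (hcμ : 1 ≤ cμ) (hD : 0 < D) (hCμ : 1 ≤ Cμ)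
    (hτ : 1 ≤ τ) {ε p : ℝ} (hε : 0 < ε) (hp : 1 ≤ p) (hpε : p < exponentGR cμ D Cμ τ ε) :
    Cμ * ε * 2 ^ p < 1 := by
  have hbase := one_lt_exponentGR_base (τ := τ) hcμ hD
  have hbase0 : 0 < 2 * cμ * (max τ 3) ^ D := by linarith
  rw [exponentGR, lt_div_iff₀ (Real.log_pos hbase), ← Real.log_rpow hbase0,
    Real.log_lt_log_iff (by positivity) (by positivity)] at hpε
  have e : Cμ⁻¹ * cμ * τ ^ D * ε⁻¹ = cμ * τ ^ D / (Cμ * ε) := by field_simp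
  rw [e, lt_div_iff₀ (by positivity)] at hpε
  have hM3 : (1 : ℝ) ≤ (max τ 3) ^ D :=
    Real.one_le_rpow (le_trans (by norm_num) (le_max_right _ _)) hD.le
  have hMτ : τ ^ D ≤ (max τ 3) ^ D :=
    Real.rpow_le_rpow (by linarith) (le_max_left _ _) hD.le
  have h2 : (2 : ℝ) ≤ 2 * cμ * (max τ 3) ^ D := by nlinarith
  have hpow : 2 ^ p * (cμ * τ ^ D) ≤ (2 * cμ * (max τ 3) ^ D) ^ p := by
    have e1 : (2 : ℝ) ^ p = 2 ^ (p - 1) * 2 := by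
      rw [← Real.rpow_add_one two_ne_zero]; ring_nf
    have e2 : (2 * cμ * (max τ 3) ^ D) ^ p =
        (2 * cμ * (max τ 3) ^ D) ^ (p - 1) * (2 * cμ * (max τ 3) ^ D) := by
      rw [← Real.rpow_add_one hbase0.ne']; ring_nf
    rw [e1, e2]
    have h3 : (2 : ℝ) ^ (p - 1) ≤ (2 * cμ * (max τ 3) ^ D) ^ (p - 1) :=
      Real.rpow_le_rpow zero_le_two h2 (by linarith)
    calc _ = (2 : ℝ) ^ (p - 1) * (2 * cμ * τ ^ D) := by ring
      _ ≤ _ := by gcongr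
  have hpos : 0 < cμ * τ ^ D := by positivity
  refine lt_of_mul_lt_mul_right (a := cμ * τ ^ D) ?_ hpos.le
  calc _ = 2 ^ p * (cμ * τ ^ D) * (Cμ * ε) := by ring
    _ ≤ _ := by gcongr
    _ < _ := hpε
    _ = _ := by ring

end Exponent

/-! ### Changes on null sets and the main theorem. -/

theorem setAverage_congr_of_subset {X : Type*} [MeasurableSpace X] {μ : Measure X}
    {f g : X → ℝ} {S T : Set X} (h : f =ᵐ[μ.restrict S] g) (hT : T ⊆ S) :
    ⨍ y in T, f y ∂μ = ⨍ y in T, g y ∂μ :=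
  average_congr (ae_restrict_of_ae_restrict_of_subset hT h)

theorem WeakGurovReshetnyakOn.congr {X : Type*} [MetricSpace X] [MeasurableSpace X]
    {μ : Measure X} {τ ε : ℝ} {v w : X → ℝ} {S : Set X} (hw : WeakGurovReshetnyakOn μ τ ε w S)
    (hτ : 1 ≤ τ) (h : w =ᵐ[μ.restrict S] v) : WeakGurovReshetnyakOn μ τ ε v S := by
  intro x r hr hS
  have hS' : ball x r ⊆ S := (ball_subset_ball (by nlinarith)).trans hS
  have h1 := hw x r hr hS
  rw [setAverage_congr_of_subset h hS, setAverage_congr_of_subset h hS'] at h1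
  refine le_trans (le_of_eq ?_) h1
  refine setAverage_congr_of_subset (S := S) ?_ hS'
  filter_upwards [h] with y hy
  rw [hy]

/-- A weight that is integrable and a.e. nonnegative on `S` agrees a.e. on `S` with a measurable,
everywhere nonnegative, integrable function. -/
theorem exists_measurable_nonneg_integrable_ae_eq {X : Type*} [MeasurableSpace X]
    {μ : Measure X} {w : X → ℝ} {S : Set X} (hS : MeasurableSet S) (hw : IntegrableOn w S μ)
    (hw0 : ∀ᵐ y ∂μ.restrict S, 0 ≤ w y) :
    ∃ v : X → ℝ, Measurable v ∧ (∀ y, 0 ≤ v y) ∧ Integrable v μ ∧ w =ᵐ[μ.restrict S] v := by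
  set m := hw.1.mk w with hm
  have hmm : Measurable m := hw.1.stronglyMeasurable_mk.measurable
  have hae : w =ᵐ[μ.restrict S] S.indicator fun y => max (m y) 0 := by
    filter_upwards [hw.1.ae_eq_mk, hw0, ae_restrict_mem hS] with y hy hy0 hyS
    rw [indicator_of_mem hyS, hm, ← hy, max_eq_left hy0]
  refine ⟨S.indicator fun y => max (m y) 0, (hmm.max measurable_const).indicator hS,
    fun y => indicator_nonneg (fun _ _ => le_max_right _ _) y, ?_, hae⟩
  rw [integrable_indicator_iff hS]
  refine Integrable.congr hw ?_
  filter_upwards [hae, ae_restrict_mem hS] with y hy hyS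
  rw [hy, indicator_of_mem hyS]

theorem mainTheorem3 {X : Type*} [MetricSpace X] [Nonempty X] [MeasurableSpace X] [BorelSpace X]
    (μ : Measure X) (hμ : IsDoubling μ) (cμ D : ℝ) (hcD : HasDoublingConstants μ cμ D) :
    ∃ Cμ : ℝ, 1 ≤ Cμ ∧ ∀ τ : ℝ, 1 ≤ τ →
      (∀ ε : ℝ, 0 < ε → ε < thresholdGR D Cμ τ → 1 < exponentGR cμ D Cμ τ ε) ∧
      Tendsto (fun ε : ℝ => exponentGR cμ D Cμ τ ε) (𝓝[>] 0) atTop ∧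
      ∀ η : ℝ, 0 < η → ∀ p : ℝ, 1 ≤ p → ∃ C : ℝ, 0 < C ∧
        ∀ ε : ℝ, 0 < ε → ε < thresholdGR D Cμ τ → p < exponentGR cμ D Cμ τ ε →
        ∀ (x₀ : X) (r₀ : ℝ), 0 < r₀ → ∀ w : X → ℝ,
          IntegrableOn w (ball x₀ (τ * ((1 + η) * r₀))) μ →
          (∀ᵐ y ∂μ.restrict (ball x₀ (τ * ((1 + η) * r₀))), 0 ≤ w y) →
          WeakGurovReshetnyakOn μ τ ε w (ball x₀ (τ * ((1 + η) * r₀))) →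
          ∀ (x : X) (r : ℝ), 0 < r →
            ball x (τ * ((1 + η) * r)) ⊆ ball x₀ (τ * ((1 + η) * r₀)) →
            (IntegrableOn (fun y => |w y - ⨍ z in ball x r, w z ∂μ| ^ p) (ball x r) μ ∧
              (⨍ y in ball x r, |w y - ⨍ z in ball x r, w z ∂μ| ^ p ∂μ) ^ (1 / p) ≤
                C * ε * ⨍ y in ball x (τ * ((1 + η) * r)), w y ∂μ) ∧
            (IntegrableOn (fun y => w y ^ p) (ball x r) μ ∧
              (⨍ y in ball x r, w y ^ p ∂μ) ^ (1 / p) ≤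
                C * ⨍ y in ball x (τ * ((1 + η) * r)), w y ∂μ) := by
  have hcμ := hcD.one_le hμ
  have hD := hcD.1
  have hCμ : 1 ≤ 24 * cμ * 6 ^ D :=
    one_le_mul_of_one_le_of_one_le (by linarith) (Real.one_le_rpow (by norm_num) hD.le)
  -- `12 cμ 6^D` is the good-λ constant (`6` from Vitali, `12 = 3 · 4` from the superlevel bounds);
  -- the extra 2 leaves room for the `L`-part of `q`.
  refine ⟨24 * cμ * 6 ^ D, hCμ, fun τ hτ => ⟨fun ε hε hε' => one_lt_exponentGR hcμ hD hCμ hτ hε hε',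
    tendsto_exponentGR_atTop hcμ hD hCμ hτ, fun η hη p hp => ?_⟩⟩
  obtain ⟨C, hC, hmain⟩ :=
    WeakGurovReshetnyakOn.exists_oscillation_and_reverse_holder hμ hcD hτ hη hp
  refine ⟨C, hC, fun ε hε _ hpε x₀ r₀ _ w hw hw0 hGR x r hr hsub => ?_⟩
  have hεp := mul_two_rpow_lt_one_of_lt_exponentGR hcμ hD hCμ hτ hε hp hpε
  obtain ⟨v, hvm, hv0, hvi, hwv⟩ :=
    exists_measurable_nonneg_integrable_ae_eq isOpen_ball.measurableSet hw hw0
  have hrsub : ball x r ⊆ ball x₀ (τ * ((1 + η) * r₀)) :=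
    (ball_subset_ball (by nlinarith [mul_pos hη hr])).trans hsub
  have hwvr : w =ᵐ[μ.restrict (ball x r)] v := ae_restrict_of_ae_restrict_of_subset hrsub hwv
  have h := hmain ε hε hεp.le v hvm hv0 hvi _ (hGR.congr hτ hwv) x r hr hsub
  rw [setAverage_congr_of_subset hwv hsub, setAverage_congr_of_subset hwv hrsub]
  have e1 : (fun y => |w y - ⨍ z in ball x r, v z ∂μ| ^ p) =ᵐ[μ.restrict (ball x r)]
      fun y => |v y - ⨍ z in ball x r, v z ∂μ| ^ p := by
    filter_upwards [hwvr] with y hy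
    rw [hy]
  have e2 : (fun y => w y ^ p) =ᵐ[μ.restrict (ball x r)] fun y => v y ^ p := by
    filter_upwards [hwvr] with y hy
    rw [hy]
  rw [average_congr e1, average_congr e2]
  exact ⟨⟨Integrable.congr h.1.1 e1.symm, h.1.2⟩, ⟨Integrable.congr h.2.1 e2.symm, h.2.2⟩⟩
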